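/- **Proposition.** Let $K$ be any field and let $\mathcal{A}$ be a hyperplane arrangement over $K$, i.e. a finite set of affine hyperplanes in $K^d$. Let $\mathcal{L}(\mathcal{A})$ be its intersection poset: the nonempty intersections of subsets of $\mathcal{A}$ (including the empty intersection $\hat 0 = K^d$), ordered by reverse inclusion, with rank function $\mathrm{rk}$ (the maximal length of a chain from $\hat 0$) and Möbius function $\mu(x)=\mu(\hat 0,x)$; let $\mathrm{rk}(\mathcal{A})$ be the maximal rank of an element. The Poincaré polynomial of $\mathcal{A}$ is $$\pi_{\mathcal{A}}(Y)=\sum_{x\in\mathcal{L}(\mathcal{A})}\mu(x)(-Y)^{\mathrm{rk}(x)}\in\mathbb{Z}[Y].$$ For $x\in\mathcal{L}(\mathcal{A})$ put $\mathcal{A}_x=\{H\in\mathcal{A}: x\subseteq H\}$ and $\mathcal{A}_\varnothing=\mathcal{A}$, let $\mathcal{A}^x=\{x\cap H: H\in\mathcal{A}\setminus\mathcal{A}_x,\ x\cap H\neq\varnothing\}$ (an arrangement in the affine space $x$), and put $\mathcal{A}^x_y=(\mathcal{A}^x)_y$. For a poset $P$ let $\Delta(P)$ be its order complex, the simplicial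 complex of finite chains of $P$. For a (possibly empty) chain $F=(x_1<\dots<x_\ell)$ in $\mathcal{L}(\mathcal{A})\setminus\{\hat 0\}$ put $x_0=\hat 0$, $x_{\ell+1}=\varnothing$, $|F|=\ell$ and $\pi_F(Y)=\prod_{k=0}^{\ell}\pi_{\mathcal{A}^{x_k}_{x_{k+1}}}(Y)$. The coarse flag Hilbert–Poincaré series of $\mathcal{A}$ is $$\mathsf{cfHP}_{\mathcal{A}}(Y,T)=\sum_{F\in\Delta(\mathcal{L}(\mathcal{A})\setminus\{\hat 0\})}\pi_F(Y)\left(\frac{T}{1-T}\right)^{|F|}\in\mathbb{Q}(T)[Y],$$ and its numerator is the polynomial $\mathcal{N}_{\mathcal{A}}(Y,T)\in\mathbb{Q}[Y,T]$ defined by $$\mathsf{cfHP}_{\mathcal{A}}(Y,T)=\frac{\mathcal{N}_{\mathcal{A}}(Y,T)}{(1-T)^{\mathrm{rk}(\mathcal{A})}}.$$ For a field $\mathbb{F}$ and a simplicial complex $\Delta$ with finite vertex set $V$, let $\mathbb{F}[\Delta]=\mathbb{F}[X_v: v\in V]/\bigl(\prod_{v\in\sigma}X_v : \sigma\subseteq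 V,\ \sigma\notin\Delta\bigr)$ be the Stanley–Reisner ring, graded by $\deg X_v=1$, and let $\mathrm{Hilb}(\mathbb{F}[\Delta],T)=\sum_{k\ge 0}\dim_{\mathbb{F}}(\mathbb{F}[\Delta]_k)\,T^k$ be its Hilbert series. Then $$\mathcal{N}_{\mathcal{A}}(Y,0)=\pi_{\mathcal{A}}(Y),$$ and for every field $\mathbb{F}$ $$\frac{\mathsf{cfHP}_{\mathcal{A}}(0,T)}{1-T}=\mathrm{Hilb}\bigl(\mathbb{F}[\Delta(\mathcal{L}(\mathcal{A}))],T\bigr),$$ where the rational function on the left is expanded as a power series in $T$. Moreover, all coefficients of the polynomials $\mathcal{N}_{\mathcal{A}}(Y,0)$ and $\mathcal{N}_{\mathcal{A}}(0,T)$ are nonnegative. -/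

import Mathlib

open Polynomial

/-- `H` is a hyperplane of the affine subspace `E` of `K^d`: a nonempty affine subspace contained
in `E`, of dimension one less than that of `E`. -/
structure IsAffineHyperplane {K : Type*} [Field K] {d : ℕ}
    (E H : AffineSubspace K (Fin d → K)) : Prop where
  nonempty : (H : Set (Fin d → K)).Nonempty
  le : H ≤ E
  finrank_eq : Module.finrank K H.direction + 1 = Module.finrank K E.direction

/-- A hyperplane arrangement: a finite set of hyperplanes in an affine space over `K`. The ambient
space is a nonempty affine subspace of `K^d`; the arrangements in `K^d` itself are those with
`ambient = ⊤`. The greater generality makes restrictions to flats arrangements again. -/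
structure HyperplaneArrangement (K : Type*) [Field K] (d : ℕ) where
  ambient : AffineSubspace K (Fin d → K)
  ambient_nonempty : (ambient : Set (Fin d → K)).Nonempty
  hyperplanes : Finset (AffineSubspace K (Fin d → K))
  isHyperplane : ∀ H ∈ hyperplanes, IsAffineHyperplane ambient H

/-- If `x` is a nonempty affine subspace of `E`, and `H` is a hyperplane of `E` that meets `x` and
does not contain it, then `x ∩ H` is a hyperplane of `x`. -/
theorem IsAffineHyperplane.inf {K : Type*} [Field K] {d : ℕ}
    {E H x : AffineSubspace K (Fin d → K)} (h : IsAffineHyperplane E H) (hxE : x ≤ E)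
    (hxH : ¬ x ≤ H) (hne : ((x ⊓ H : AffineSubspace K (Fin d → K)) : Set (Fin d → K)).Nonempty) :
    IsAffineHyperplane x (x ⊓ H) := by
  obtain ⟨p, hp⟩ := hne
  refine ⟨⟨p, hp⟩, inf_le_left, ?_⟩
  have hdir := AffineSubspace.direction_inf_of_mem_inf (k := K) (p := p) (s₁ := x) (s₂ := H) hp
  have hpx : p ∈ x := hp.1
  have hpH : p ∈ H := hp.2
  have h1 : ¬ x.direction ≤ H.direction := by
    intro hle
    apply hxH
    intro q hq
    have : q -ᵥ p ∈ H.direction := hle (AffineSubspace.vsub_mem_direction hq hpx)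
    have := AffineSubspace.vadd_mem_of_mem_direction this hpH
    simpa using this
  have hxE' := AffineSubspace.direction_le hxE
  have hHE' := AffineSubspace.direction_le h.le
  have h2 := Submodule.finrank_sup_add_finrank_inf_eq x.direction H.direction
  have h3 : Module.finrank K H.direction
      < Module.finrank K (x.direction ⊔ H.direction : Submodule K (Fin d → K)) := by
    apply Submodule.finrank_lt_finrank_of_lt
    refine lt_of_le_of_ne le_sup_right ?_
    intro he
    exact h1 (he ▸ le_sup_left)
  have h4 : Module.finrank K (x.direction ⊔ H.direction : Submodule K (Fin d → K))
      ≤ Module.finrank K E.direction := Submodule.finrank_mono (sup_le hxE' hHE')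
  have h5 := h.finrank_eq
  rw [hdir]
  omega

/-- The order complex `Δ(P)` of a poset `P`: its faces are the nonempty finite chains of `P`
(in Mathlib's convention the empty face is not listed). -/
def orderComplex (P : Type*) [PartialOrder P] : AbstractSimplicialComplex P where
  faces := {σ | σ.Nonempty ∧ IsChain (· ≤ ·) (σ : Set P)}
  isRelLowerSet_faces := fun _σ hσ =>
    ⟨hσ.1, fun _τ hτσ hτ => ⟨hτ, hσ.2.mono (Finset.coe_subset.mpr hτσ)⟩⟩
  singleton_mem := fun v => ⟨Finset.singleton_nonempty v, by simp [IsChain]⟩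

section StanleyReisner

/-- The Stanley-Reisner ideal of `Δ` over `F`, generated by the squarefree monomials
`∏_{v ∈ σ} X_v` where `σ` is a non-face of `Δ` (the empty set counts as a face). -/
noncomputable def stanleyReisnerIdeal (F : Type*) [Field F] {ι : Type*} (Δ : AbstractSimplicialComplex ι) :
    Ideal (MvPolynomial ι F) :=
  Ideal.span {m | ∃ σ : Finset ι, σ.Nonempty ∧ σ ∉ Δ.faces ∧
    m = ∏ v ∈ σ, (MvPolynomial.X v : MvPolynomial ι F)}

/-- The Stanley-Reisner ring `F[Δ]`. -/
abbrev StanleyReisnerRing (F : Type*) [Field F] {ι : Type*} (Δ : AbstractSimplicialComplex ι) :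
    Type _ :=
  MvPolynomial ι F ⧸ stanleyReisnerIdeal F Δ

/-- The graded piece `F[Δ]_k`, for the grading in which every variable has degree one: the classes
of the homogeneous polynomials of degree `k`. -/
noncomputable def stanleyReisnerPiece (F : Type*) [Field F] {ι : Type*}
    (Δ : AbstractSimplicialComplex ι) (k : ℕ) : Submodule F (StanleyReisnerRing F Δ) :=
  (MvPolynomial.homogeneousSubmodule ι F k).map
    (Ideal.Quotient.mkₐ F (stanleyReisnerIdeal F Δ)).toLinearMap

/-- The (coarse) Hilbert series `∑_k dim_F(F[Δ]_k) T^k` of the Stanley-Reisner ring `F[Δ]`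
(of a complex with finitely many vertices), with rational coefficients. -/
noncomputable def stanleyReisnerHilbertSeries (F : Type*) [Field F] {ι : Type*}
    (Δ : AbstractSimplicialComplex ι) : PowerSeries ℚ :=
  PowerSeries.mk fun k => (Module.finrank F (stanleyReisnerPiece F Δ k) : ℚ)

open scoped RatFunc in
/-- The expansion of a rational function in `ℚ(T)` as a formal Laurent series at `T = 0`. -/
noncomputable def laurentExpansion : RatFunc ℚ →+* LaurentSeries ℚ :=
  algebraMap (RatFunc ℚ) (LaurentSeries ℚ)

end StanleyReisner

namespace HyperplaneArrangement

variable {K : Type*} [Field K] {d : ℕ}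

/-- The nonempty intersections of subsets of the arrangement; the empty subset gives the ambient
space. -/
def IsFlat (A : HyperplaneArrangement K d) (x : AffineSubspace K (Fin d → K)) : Prop :=
  (x : Set (Fin d → K)).Nonempty ∧
    ∃ B : Finset (AffineSubspace K (Fin d → K)), B ⊆ A.hyperplanes ∧
      x = A.ambient ⊓ ⨅ H ∈ B, H

/-- The intersection poset `L(A)`, ordered by reverse inclusion. -/
abbrev IntersectionPoset (A : HyperplaneArrangement K d) : Type _ :=
  {x : (AffineSubspace K (Fin d → K))ᵒᵈ // A.IsFlat (OrderDual.ofDual x)}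

/-- The affine subspace underlying an element of the intersection poset. -/
def IntersectionPoset.space {A : HyperplaneArrangement K d} (x : A.IntersectionPoset) :
    AffineSubspace K (Fin d → K) :=
  OrderDual.ofDual x.1

theorem IntersectionPoset.space_le_ambient {A : HyperplaneArrangement K d}
    (x : A.IntersectionPoset) : x.space ≤ A.ambient := by
  obtain ⟨_, B, _, hB⟩ := x.2
  unfold IntersectionPoset.space
  rw [hB]
  exact inf_le_left

instance (A : HyperplaneArrangement K d) : Finite A.IntersectionPoset := by
  classical
  let f : A.IntersectionPoset → A.hyperplanes.powerset := fun x =>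
    ⟨x.2.2.choose, Finset.mem_powerset.mpr x.2.2.choose_spec.1⟩
  refine Finite.of_injective f ?_
  intro x y hxy
  have h : x.2.2.choose = y.2.2.choose := congrArg Subtype.val hxy
  apply Subtype.ext
  apply OrderDual.ofDual.injective
  rw [x.2.2.choose_spec.2, y.2.2.choose_spec.2, h]

noncomputable instance (A : HyperplaneArrangement K d) : Fintype A.IntersectionPoset :=
  Fintype.ofFinite _

/-- The bottom element `0̂` of the intersection poset is the ambient space. -/
instance (A : HyperplaneArrangement K d) : OrderBot A.IntersectionPoset where
  bot := ⟨OrderDual.toDual A.ambient, A.ambient_nonempty, ∅, by simp, by simp⟩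
  bot_le x := x.space_le_ambient

/-- The rank of `x` in `L(A)`: the supremum of the lengths of the chains ending in `x`. -/
noncomputable def rk (A : HyperplaneArrangement K d) (x : A.IntersectionPoset) : ℕ :=
  (Order.height x).toNat

/-- The rank of `A`: the largest rank of an element of `L(A)`. -/
noncomputable def rank (A : HyperplaneArrangement K d) : ℕ :=
  Finset.univ.sup A.rk

open scoped Classical in
/-- The Möbius function value `μ(x) = μ(0̂, x)` of `L(A)`. -/
noncomputable def moebius (A : HyperplaneArrangement K d) (x : A.IntersectionPoset) : ℤ :=
  letI : LocallyFiniteOrder A.IntersectionPoset := Fintype.toLocallyFiniteOrder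
  IncidenceAlgebra.mu ℤ ⊥ x

/-- The Poincaré polynomial `π_A(Y) = ∑_{x ∈ L(A)} μ(x) (-Y)^{rk x}`. -/
noncomputable def poincare (A : HyperplaneArrangement K d) : ℤ[X] :=
  ∑ x : A.IntersectionPoset, C (A.moebius x) * (-X) ^ A.rk x

open scoped Classical in
/-- The subarrangement `A_y = {H ∈ A | y ⊆ H}`. For `y = ∅` (that is, `y = ⊥`) this is `A`. -/
noncomputable def sub (A : HyperplaneArrangement K d) (y : AffineSubspace K (Fin d → K)) :
    HyperplaneArrangement K d where
  ambient := A.ambient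
  ambient_nonempty := A.ambient_nonempty
  hyperplanes := A.hyperplanes.filter fun H => y ≤ H
  isHyperplane H hH := A.isHyperplane H (Finset.mem_filter.mp hH).1

open scoped Classical in
/-- The restriction `A^x = {x ∩ H | H ∈ A ∖ A_x, x ∩ H ≠ ∅}`, an arrangement in the flat `x`. -/
noncomputable def restrict (A : HyperplaneArrangement K d) (x : A.IntersectionPoset) :
    HyperplaneArrangement K d where
  ambient := x.space
  ambient_nonempty := x.2.1
  hyperplanes := (A.hyperplanes.filter fun H => ¬ x.space ≤ H ∧
    ((x.space ⊓ H : AffineSubspace K (Fin d → K)) : Set (Fin d → K)).Nonempty).image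
      fun H => x.space ⊓ H
  isHyperplane := by
    intro H' hH'
    obtain ⟨H, hH, rfl⟩ := Finset.mem_image.mp hH'
    obtain ⟨hHA, hxH, hne⟩ := Finset.mem_filter.mp hH
    exact (A.isHyperplane H hHA).inf x.space_le_ambient hxH hne

/-- For a flag `F = (x_1 < ⋯ < x_ℓ)` and an element `x`: the first member of `F` that is strictly
greater than `x` in `L(A)`, as an affine subspace, and `∅` if there is none. Since `L(A)` is ordered
by reverse inclusion, that member is the largest subspace among those of the later members, that
is, their supremum. -/
noncomputable def next (A : HyperplaneArrangement K d) (F : Finset A.IntersectionPoset)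
    (x : A.IntersectionPoset) : AffineSubspace K (Fin d → K) :=
  ⨆ y ∈ F, ⨆ _ : x < y, y.space

open scoped Classical in
/-- The flag Poincaré polynomial `π_F(Y) = ∏_{k=0}^{ℓ} π_{A^{x_k}_{x_{k+1}}}(Y)` of a flag
`F = (x_1 < ⋯ < x_ℓ)`, where `x_0 = 0̂` and `x_{ℓ+1} = ∅`. -/
noncomputable def flagPoincare (A : HyperplaneArrangement K d) (F : Finset A.IntersectionPoset) :
    ℤ[X] :=
  ∏ x ∈ insert ⊥ F, ((A.restrict x).sub (A.next F x)).poincare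

open scoped Classical in
/-- The faces of `Δ(L(A) ∖ {0̂})`, with the empty flag: the chains of `L(A)` that avoid `0̂`. -/
noncomputable def flags (A : HyperplaneArrangement K d) : Finset (Finset A.IntersectionPoset) :=
  Finset.univ.filter fun F => IsChain (· ≤ ·) (F : Set A.IntersectionPoset) ∧ ⊥ ∉ F

/-- The coarse flag Hilbert-Poincaré series
`cfHP_A(Y, T) = ∑_F π_F(Y) (T / (1 - T))^{|F|}`, an element of `ℚ(T)[Y]`. -/
noncomputable def coarseFlagHP (A : HyperplaneArrangement K d) : (RatFunc ℚ)[X] :=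
  ∑ F ∈ A.flags, (A.flagPoincare F).map (Int.castRingHom (RatFunc ℚ)) *
    C ((RatFunc.X / (1 - RatFunc.X)) ^ F.card)

/-- `N ∈ ℚ[T][Y]` satisfies `cfHP_A(Y, T) = N(Y, T) / (1 - T)^{rank A}`. The variable of the outer
polynomial ring is `Y`, the variable of the inner one is `T`. -/
def IsCoarseNumerator (A : HyperplaneArrangement K d) (N : ℚ[X][X]) : Prop :=
  A.coarseFlagHP =
    N.map (algebraMap ℚ[X] (RatFunc ℚ)) * C (((1 - RatFunc.X) ^ A.rank)⁻¹)

theorem card_le_rank (A : HyperplaneArrangement K d) {F : Finset A.IntersectionPoset}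
    (hF : F ∈ A.flags) : F.card ≤ A.rank := by
  classical
  obtain ⟨hc, hb⟩ := (Finset.mem_filter.mp hF).2
  have hfin : ∀ x : A.IntersectionPoset, Order.height x < ⊤ := by
    intro x
    refine lt_of_le_of_lt (b := ((Fintype.card A.IntersectionPoset : ℕ) : ℕ∞)) ?_
      (ENat.natCast_lt_top _)
    refine Order.height_le fun p _ => ?_
    exact_mod_cast (LTSeries.length_lt_card p).le
  have hlt : ∀ x y : A.IntersectionPoset, x < y → A.rk x < A.rk y := fun x y hxy =>
    by
    have h := Order.height_strictMono hxy (hfin x)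
    unfold rk
    rwa [← ENat.natCast_toNat (hfin x).ne, ← ENat.natCast_toNat (hfin y).ne, Nat.cast_lt] at h
  have hinj : Set.InjOn A.rk (F : Set A.IntersectionPoset) := by
    intro x hx y hy hxy
    by_contra hne
    rcases hc hx hy hne with h | h
    · exact (hlt _ _ (lt_of_le_of_ne h hne)).ne hxy
    · exact (hlt _ _ (lt_of_le_of_ne h (Ne.symm hne))).ne' hxy
  have hmaps : ∀ x ∈ F, A.rk x ∈ Finset.Icc 1 A.rank := by
    intro x hx
    have hx0 : (⊥ : A.IntersectionPoset) < x :=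
      bot_lt_iff_ne_bot.mpr fun h => hb (h ▸ hx)
    have := hlt _ _ hx0
    have h2 : A.rk x ≤ A.rank := Finset.le_sup (f := A.rk) (Finset.mem_univ x)
    exact Finset.mem_Icc.mpr ⟨by omega, h2⟩
  simpa using Finset.card_le_card_of_injOn A.rk hmaps hinj

theorem existsUnique_coarseNumerator (A : HyperplaneArrangement K d) :
    ∃! N : ℚ[X][X], A.IsCoarseNumerator N := by
  have h1 : (1 - RatFunc.X : RatFunc ℚ) = algebraMap ℚ[X] (RatFunc ℚ) (1 - X) := by simp
  have h0 : (1 - RatFunc.X : RatFunc ℚ) ≠ 0 := by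
    rw [h1, Ne, map_eq_zero_iff _ (RatFunc.algebraMap_injective ℚ)]
    intro h
    have := congrArg (Polynomial.eval 0) h
    simp at this
  have hu : ∀ N : ℚ[X][X], A.IsCoarseNumerator N ↔
      N.map (algebraMap ℚ[X] (RatFunc ℚ)) = A.coarseFlagHP * C ((1 - RatFunc.X) ^ A.rank) := by
    intro N
    have hC : (C (((1 - RatFunc.X : RatFunc ℚ) ^ A.rank)⁻¹) : (RatFunc ℚ)[X]) *
        C ((1 - RatFunc.X) ^ A.rank) = 1 := by
      rw [← C_mul, inv_mul_cancel₀ (pow_ne_zero _ h0), C_1]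
    unfold IsCoarseNumerator
    constructor
    · intro h
      rw [h, mul_assoc, hC, mul_one]
    · intro h
      rw [h, mul_assoc, mul_comm (C _) (C _), hC, mul_one]
  have hring : (algebraMap ℚ[X] (RatFunc ℚ)).comp (Int.castRingHom ℚ[X]) =
      Int.castRingHom (RatFunc ℚ) := RingHom.ext_int _ _
  have hN : (∑ F ∈ A.flags, (A.flagPoincare F).map (Int.castRingHom ℚ[X]) *
      C (X ^ F.card * (1 - X) ^ (A.rank - F.card))).map (algebraMap ℚ[X] (RatFunc ℚ)) =
      A.coarseFlagHP * C ((1 - RatFunc.X) ^ A.rank) := by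
    rw [coarseFlagHP, Finset.sum_mul, Polynomial.map_sum]
    refine Finset.sum_congr rfl fun F hF => ?_
    rw [Polynomial.map_mul, Polynomial.map_map, hring, mul_assoc, ← C_mul, Polynomial.map_C]
    congr 2
    rw [map_mul, map_pow, map_pow, ← h1, RatFunc.algebraMap_X, div_pow]
    have hle := A.card_le_rank hF
    have : (1 - RatFunc.X : RatFunc ℚ) ^ A.rank
        = (1 - RatFunc.X) ^ F.card * (1 - RatFunc.X) ^ (A.rank - F.card) := by
      rw [← pow_add]; congr 1; omega
    rw [this]
    have h2 := pow_ne_zero F.card h0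
    field_simp
  refine ⟨_, (hu _).mpr hN, fun N hN' => ?_⟩
  apply Polynomial.map_injective _ (RatFunc.algebraMap_injective ℚ)
  rw [(hu N).mp hN', hN]

/-- The numerator `N_A(Y, T)`, defined by `cfHP_A(Y, T) = N_A(Y, T) / (1 - T)^{rank A}`. -/
noncomputable def coarseNumerator (A : HyperplaneArrangement K d) : ℚ[X][X] :=
  A.existsUnique_coarseNumerator.choose

theorem coarseNumerator_spec (A : HyperplaneArrangement K d) :
    A.IsCoarseNumerator A.coarseNumerator :=
  A.existsUnique_coarseNumerator.choose_spec.1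

/-- The polynomial `N_A(Y, 0)` in `Y`. -/
noncomputable def coarseNumeratorTZero (A : HyperplaneArrangement K d) : ℚ[X] :=
  A.coarseNumerator.map (evalRingHom 0)

/-- The polynomial `N_A(0, T)` in `T`. -/
noncomputable def coarseNumeratorYZero (A : HyperplaneArrangement K d) : ℚ[X] :=
  A.coarseNumerator.eval 0

end HyperplaneArrangement

/-!
At `T = 0` only the empty flag contributes to `cfHP_A`, and its term is `π_A`. At `Y = 0` every
`π_F` is `1`, so `N_A(0, T)` is the `h`-polynomial of the order complex of `L(A) ∖ {0̂}`. The order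
complex of `L(A)` is a cone over that complex, which accounts for the extra factor `1 / (1 - T)` in
the Hilbert series of its Stanley-Reisner ring.

Nonnegativity rests on `L(A)` being a geometric semilattice. Pairs of flats that meet have
semimodular joins, so the Möbius function alternates in sign by Weisner's theorem. The complex of
`L(A) ∖ {0̂}` is glued together from the cones over the covers of `0̂`, one cover at a time, each
along the part generated by its own covers that lie above earlier ones. In a suitable order that
part has an `h`-polynomial between `0` and that of the whole link, so the coefficients only grow.
-/

section OrderComplex

variable {P : Type*} [PartialOrder P] [Fintype P]

open scoped Classical in
/-- The finite chains contained in `s`, the empty one included: the faces of the order complex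
of the subposet `s`. -/
noncomputable def chainsIn (s : Set P) : Finset (Finset P) :=
  Finset.univ.filter fun F => IsChain (· ≤ ·) (F : Set P) ∧ ↑F ⊆ s

theorem mem_chainsIn {s : Set P} {F : Finset P} :
    F ∈ chainsIn s ↔ IsChain (· ≤ ·) (F : Set P) ∧ ↑F ⊆ s := by
  simp [chainsIn]

theorem empty_mem_chainsIn (s : Set P) : ∅ ∈ chainsIn s := by
  simp [mem_chainsIn, IsChain.empty]

theorem chainsIn_empty : chainsIn (∅ : Set P) = {∅} := by
  ext F
  simp only [mem_chainsIn, Set.subset_empty_iff, Finset.coe_eq_empty, Finset.mem_singleton,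
    and_iff_right_iff_imp]
  rintro rfl
  simp [IsChain.empty]

open scoped Classical in
theorem chainsIn_inter (s t : Set P) : chainsIn (s ∩ t) = chainsIn s ∩ chainsIn t := by
  ext F
  simp only [mem_chainsIn, Set.subset_inter_iff, Finset.mem_inter]
  tauto

open scoped Classical in
theorem chainsIn_union {s t : Set P} (hs : IsUpperSet s) (ht : IsUpperSet t) :
    chainsIn (s ∪ t) = chainsIn s ∪ chainsIn t := by
  ext F
  simp only [mem_chainsIn, Finset.mem_union, ← and_or_left]
  refine and_congr_right fun hF =>
    ⟨fun hst => or_iff_not_imp_left.mpr fun hFs => ?_,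
      Or.rec (Set.subset_union_of_subset_left · t) (Set.subset_union_of_subset_right · s)⟩
  obtain ⟨y, hyF, hys⟩ := Set.not_subset.mp hFs
  intro z hz
  rcases hF.total hyF hz with hyz | hzy
  · exact ht hyz ((hst hyF).resolve_left hys)
  · exact (hst hz).resolve_left fun hzs => hys (hs hzy hzs)

open scoped Classical in
theorem chainsIn_Ici (b : P) :
    chainsIn (Set.Ici b) =
      chainsIn (Set.Ioi b) ∪ (chainsIn (Set.Ioi b)).image (insert b) := by
  ext F
  simp only [Finset.mem_union, Finset.mem_image, mem_chainsIn]
  constructor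
  · rintro ⟨hF, hb⟩
    by_cases hbF : b ∈ F
    · refine Or.inr ⟨F.erase b, ⟨hF.mono (by simp), fun y hy => ?_⟩, Finset.insert_erase hbF⟩
      obtain ⟨hyb, hyF⟩ := Finset.mem_erase.mp hy
      exact lt_of_le_of_ne (hb hyF) hyb.symm
    · exact Or.inl ⟨hF, fun y hy => lt_of_le_of_ne (hb hy) fun h => hbF (h ▸ hy)⟩
  · rintro (⟨hF, hb⟩ | ⟨G, ⟨hG, hb⟩, rfl⟩)
    · exact ⟨hF, hb.trans Set.Ioi_subset_Ici_self⟩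
    · rw [Finset.coe_insert]
      exact ⟨hG.insert fun y hy _ => Or.inl (hb hy).le,
        Set.insert_subset Set.self_mem_Ici (hb.trans Set.Ioi_subset_Ici_self)⟩

open scoped Classical in
theorem sum_chainsIn_Ici {M : Type*} [AddCommMonoid M] (b : P) (f : Finset P → M) :
    ∑ F ∈ chainsIn (Set.Ici b), f F = ∑ F ∈ chainsIn (Set.Ioi b), (f F + f (insert b F)) := by
  have hb : ∀ F ∈ chainsIn (Set.Ioi b), b ∉ F := fun F hF hbF =>
    lt_irrefl b ((mem_chainsIn.mp hF).2 hbF)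
  rw [chainsIn_Ici, Finset.sum_union, Finset.sum_image, Finset.sum_add_distrib]
  · exact Finset.insert_erase_invOn.2.injOn.mono hb
  · rw [Finset.disjoint_right]
    rintro _ hF hF'
    obtain ⟨G, -, rfl⟩ := Finset.mem_image.mp hF
    exact hb _ hF' (Finset.mem_insert_self b G)

theorem sum_chainsIn_Ici_pow_card {R : Type*} [CommSemiring R] (b : P) (t : R) :
    ∑ F ∈ chainsIn (Set.Ici b), t ^ F.card =
      (1 + t) * ∑ F ∈ chainsIn (Set.Ioi b), t ^ F.card := by
  classical
  rw [sum_chainsIn_Ici, Finset.mul_sum]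
  refine Finset.sum_congr rfl fun F hF => ?_
  rw [Finset.card_insert_of_notMem fun hbF => lt_irrefl b ((mem_chainsIn.mp hF).2 hbF)]
  ring

theorem card_le_of_mem_chainsIn_Ioi {e : P → ℕ} (he : StrictAnti e) {b : P} {F : Finset P}
    (hF : F ∈ chainsIn (Set.Ioi b)) : F.card ≤ e b := by
  obtain ⟨hchain, hb⟩ := mem_chainsIn.mp hF
  have hinj : Set.InjOn e (F : Set P) := fun y hy z hz hyz => by
    by_contra hne
    rcases hchain.total hy hz with h | h
    · exact (he (lt_of_le_of_ne h hne)).ne' hyz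
    · exact (he (lt_of_le_of_ne h (Ne.symm hne))).ne hyz
  have hmaps : ∀ y ∈ F, e y ∈ Finset.range (e b) := fun y hy => Finset.mem_range.mpr (he (hb hy))
  simpa using Finset.card_le_card_of_injOn e hmaps hinj

/-- The `h`-polynomial of the order complex of `s`, regarded as a complex of dimension `n - 1`.
The subtraction is truncated, so `n` has to bound the cardinalities of the chains in `s`. -/
noncomputable def hPolynomial (n : ℕ) (s : Set P) : ℚ[X] :=
  ∑ F ∈ chainsIn s, X ^ F.card * (1 - X) ^ (n - F.card)

theorem hPolynomial_empty (n : ℕ) : hPolynomial n (∅ : Set P) = (1 - X) ^ n := by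
  simp [hPolynomial, chainsIn_empty]

theorem hPolynomial_union_add_inter (n : ℕ) {s t : Set P} (hs : IsUpperSet s)
    (ht : IsUpperSet t) :
    hPolynomial n (s ∪ t) + hPolynomial n (s ∩ t) = hPolynomial n s + hPolynomial n t := by
  classical
  rw [hPolynomial, hPolynomial, chainsIn_union hs ht, chainsIn_inter, Finset.sum_union_inter]
  rfl

theorem hPolynomial_succ {n : ℕ} {s : Set P} (hn : ∀ F ∈ chainsIn s, F.card ≤ n) :
    hPolynomial (n + 1) s = (1 - X) * hPolynomial n s := by
  rw [hPolynomial, hPolynomial, Finset.mul_sum]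
  refine Finset.sum_congr rfl fun F hF => ?_
  rw [Nat.sub_add_comm (hn F hF), pow_succ]
  ring

theorem hPolynomial_succ_Ici {n : ℕ} {b : P} (hn : ∀ F ∈ chainsIn (Set.Ioi b), F.card ≤ n) :
    hPolynomial (n + 1) (Set.Ici b) = hPolynomial n (Set.Ioi b) := by
  classical
  rw [hPolynomial, hPolynomial, sum_chainsIn_Ici]
  refine Finset.sum_congr rfl fun F hF => ?_
  rw [Finset.card_insert_of_notMem fun hbF => lt_irrefl b ((mem_chainsIn.mp hF).2 hbF),
    Nat.sub_add_comm (hn F hF), Nat.add_sub_add_right]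
  ring

end OrderComplex

section Shelling

variable {P : Type*} [PartialOrder P]

/-- Semimodularity of a poset in which only bounded pairs need to have joins: if `a` covers `x`,
`x ≤ y`, and `a`, `y` have an upper bound, then they have a join, which is `y` or covers `y`. -/
def IsUpperSemimodular (P : Type*) [PartialOrder P] : Prop :=
  ∀ ⦃x a y z : P⦄, x ⋖ a → x ≤ y → a ≤ z → y ≤ z → ∃ w, IsLUB {y, a} w ∧ y ⩿ w

/-- The covers of `b` that lie above some element of `B`. -/
def coverTrace (b : P) (B : Set P) : Set P :=
  {y | b ⋖ y ∧ y ∈ upperClosure B}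

theorem IsUpperSemimodular.upperClosure_coverTrace (hP : IsUpperSemimodular P) {x b : P}
    {B : Set P} (hB : ∀ a ∈ B, x ⋖ a) (hb : x ⋖ b) (hbB : b ∉ B) :
    (upperClosure (coverTrace b B) : Set P) = ↑(upperClosure B) ∩ Set.Ici b := by
  ext z
  constructor
  · rintro ⟨y, ⟨hby, hyB⟩, hyz⟩
    exact ⟨(upperClosure B).upper hyz hyB, hby.le.trans hyz⟩
  · rintro ⟨⟨a, haB, haz⟩, (hbz : b ≤ z)⟩
    obtain ⟨w, hw, hbw⟩ := hP (hB a haB) hb.le haz hbz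
    have haw : a ≤ w := hw.1 (by simp)
    have hne : b ≠ w := by
      rintro rfl
      rcases hb.eq_or_eq (hB a haB).le haw with h | h
      · exact (hB a haB).ne' h
      · exact hbB (h ▸ haB)
    exact ⟨w, ⟨hbw.covBy_of_ne hne, a, haB, haw⟩, hw.2 (by simp [upperBounds, hbz, haz])⟩

/-- `e` is the corank function of a pure poset: it decreases by one along covers, down to the
value `0`, which it takes at every maximal element. -/
structure IsCorank (e : P → ℕ) : Prop where
  covBy ⦃x b : P⦄ : x ⋖ b → e b + 1 = e x
  isMax ⦃x : P⦄ : IsMax x → e x = 0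

/-- A family of sets of covers that makes the poset recursively shellable. A good set of covers of
`x` plays the role of an initial segment in some recursive ordering of all covers of `x`: it can be
enlarged and diminished by one cover `b` at a time, and the part of the order complex along which
`b` is glued on is again described by a good set, of covers of `b`. -/
structure IsShellingFamily (Good : P → Set P → Prop) : Prop where
  covBy ⦃x : P⦄ ⦃B : Set P⦄ : Good x B → ∀ b ∈ B, x ⋖ b
  covers (x : P) : Good x {b | x ⋖ b}
  isMax_of_empty ⦃x : P⦄ : Good x ∅ → IsMax x
  exists_insert ⦃x : P⦄ ⦃B : Set P⦄ : Good x B → B ≠ {b | x ⋖ b} →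
    ∃ b ∉ B, x ⋖ b ∧ Good x (insert b B) ∧ Good b (coverTrace b B)
  exists_diff ⦃x : P⦄ ⦃B : Set P⦄ : Good x B → B.Subsingleton ∨
    ∃ b ∈ B, Good x (B \ {b}) ∧ Good b (coverTrace b (B \ {b}))

theorem upperClosure_covers [IsStronglyAtomic P] (x : P) :
    (upperClosure {b | x ⋖ b} : Set P) = Set.Ioi x := by
  ext z
  constructor
  · rintro ⟨b, hb, hbz⟩
    exact (CovBy.lt hb).trans_le hbz
  · intro hz
    obtain ⟨b, hb, hbz⟩ := exists_covBy_le_of_lt hz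
    exact ⟨b, hb, hbz⟩

variable {e : P → ℕ}

theorem IsCorank.strictAnti [Finite P] (he : IsCorank e) : StrictAnti e := by
  classical
  let _ := Fintype.ofFinite P
  let _ : LocallyFiniteOrder P := Fintype.toLocallyFiniteOrder
  refine (strictAnti_iff_forall_covBy e).mpr fun x b hb => ?_
  have := he.covBy hb
  omega

variable [Fintype P]

theorem IsCorank.hPolynomial_Ici (he : IsCorank e) {x b : P} (hb : x ⋖ b) :
    hPolynomial (e x) (Set.Ici b) = hPolynomial (e b) (Set.Ioi b) := by
  rw [← he.covBy hb]
  exact hPolynomial_succ_Ici fun F hF => card_le_of_mem_chainsIn_Ioi he.strictAnti hF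

theorem IsCorank.hPolynomial_upperClosure_insert (he : IsCorank e) (hP : IsUpperSemimodular P)
    {x b : P} {B : Set P} (hB : ∀ a ∈ B, x ⋖ a) (hb : x ⋖ b) (hbB : b ∉ B) :
    hPolynomial (e x) (upperClosure (insert b B) : Set P) =
      hPolynomial (e x) (upperClosure B : Set P) +
        (hPolynomial (e b) (Set.Ioi b) -
          (1 - X) * hPolynomial (e b) (upperClosure (coverTrace b B) : Set P)) := by
  have hunion : (upperClosure (insert b B) : Set P) = ↑(upperClosure B) ∪ Set.Ici b := by
    rw [Set.insert_eq, Set.union_comm, upperClosure_union, upperClosure_singleton]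
    rfl
  have htrace : ((upperClosure (coverTrace b B) : UpperSet P) : Set P) ⊆ Set.Ioi b := by
    rintro z ⟨y, hy, hyz⟩
    exact hy.1.lt.trans_le hyz
  have hsucc : hPolynomial (e x) (upperClosure (coverTrace b B) : Set P) =
      (1 - X) * hPolynomial (e b) (upperClosure (coverTrace b B) : Set P) := by
    rw [← he.covBy hb]
    refine hPolynomial_succ fun F hF => card_le_of_mem_chainsIn_Ioi he.strictAnti ?_
    exact mem_chainsIn.mpr ((mem_chainsIn.mp hF).imp_right fun h => h.trans htrace)
  have hincl := hPolynomial_union_add_inter (e x) (upperClosure B).upper (isUpperSet_Ici b)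
  rw [← hunion, ← hP.upperClosure_coverTrace hB hb hbB, hsucc, he.hPolynomial_Ici hb] at hincl
  linear_combination hincl

theorem coeff_X_mul_nonneg {R : Type*} [Semiring R] [PartialOrder R] {p : R[X]}
    (hp : 0 ≤ p.coeff) : 0 ≤ (X * p).coeff := by
  rintro (_ | k)
  · simp
  · exact (hp k).trans_eq (coeff_X_mul p k).symm

/-- Adding the cover `b` adds `h_b - (1 - X) h_t = (h_b - h_t) + X h_t` to the `h`-polynomial, where
`h_t` belongs to the trace. -/
theorem IsCorank.coeff_hPolynomial_le_insert (he : IsCorank e) (hP : IsUpperSemimodular P)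
    {x b : P} {B : Set P} (hB : ∀ a ∈ B, x ⋖ a) (hb : x ⋖ b) (hbB : b ∉ B)
    (htrace : (hPolynomial (e b) (upperClosure (coverTrace b B) : Set P)).coeff ∈
      Set.Icc 0 (hPolynomial (e b) (Set.Ioi b)).coeff) :
    (hPolynomial (e x) (upperClosure B : Set P)).coeff ≤
      (hPolynomial (e x) (upperClosure (insert b B) : Set P)).coeff := by
  intro k
  have hle := htrace.2 k
  have hnonneg : 0 ≤ (X * hPolynomial (e b) (upperClosure (coverTrace b B) : Set P)).coeff k :=
    coeff_X_mul_nonneg htrace.1 k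
  rw [he.hPolynomial_upperClosure_insert hP hB hb hbB, one_sub_mul]
  simp only [coeff_add, coeff_sub]
  linarith

namespace IsShellingFamily

variable {Good : P → Set P → Prop}

theorem coeff_hPolynomial_nonneg_of_covers (h : IsShellingFamily Good) (he : IsCorank e)
    (hP : IsUpperSemimodular P) {x : P}
    (ih : ∀ b, x ⋖ b → ∀ B, Good b B → (hPolynomial (e b) (upperClosure B : Set P)).coeff ∈
      Set.Icc 0 (hPolynomial (e b) (Set.Ioi b)).coeff) {B : Set P} (hB : Good x B) :
    0 ≤ (hPolynomial (e x) (upperClosure B : Set P)).coeff := by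
  induction B using WellFoundedLT.induction with
  | _ B ihB =>
  rcases h.exists_diff hB with hsub | ⟨b, hbB, hgood, htrace⟩
  · rcases hsub.eq_empty_or_singleton with rfl | ⟨b, rfl⟩
    · intro k
      rw [upperClosure_empty, UpperSet.coe_top, hPolynomial_empty,
        he.isMax (h.isMax_of_empty hB), pow_zero, coeff_one, Pi.zero_apply]
      positivity
    · have hb : x ⋖ b := h.covBy hB b rfl
      rw [upperClosure_singleton, UpperSet.coe_Ici, he.hPolynomial_Ici hb,
        ← upperClosure_covers]
      exact (ih b hb _ (h.covers b)).1
  · have hb : x ⋖ b := h.covBy hB b hbB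
    have hstep := he.coeff_hPolynomial_le_insert hP (h.covBy hgood) hb (by simp)
      (ih b hb _ htrace)
    rw [Set.insert_sdiff_singleton, Set.insert_eq_of_mem hbB] at hstep
    exact (ihB _ (Set.sdiff_singleton_ssubset.mpr hbB) hgood).trans hstep

theorem coeff_hPolynomial_le_of_covers (h : IsShellingFamily Good) (he : IsCorank e)
    (hP : IsUpperSemimodular P) {x : P}
    (ih : ∀ b, x ⋖ b → ∀ B, Good b B → (hPolynomial (e b) (upperClosure B : Set P)).coeff ∈
      Set.Icc 0 (hPolynomial (e b) (Set.Ioi b)).coeff) {B : Set P} (hB : Good x B) :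
    (hPolynomial (e x) (upperClosure B : Set P)).coeff ≤
      (hPolynomial (e x) (Set.Ioi x)).coeff := by
  induction B using WellFoundedGT.induction with
  | _ B ihB =>
  by_cases hcovers : B = {b | x ⋖ b}
  · rw [hcovers, upperClosure_covers]
  · obtain ⟨b, hbB, hb, hgood, htrace⟩ := h.exists_insert hB hcovers
    exact (he.coeff_hPolynomial_le_insert hP (h.covBy hB) hb hbB (ih b hb _ htrace)).trans
      (ihB _ (Set.ssubset_insert hbB) hgood)

theorem coeff_hPolynomial_mem_Icc (h : IsShellingFamily Good) (he : IsCorank e)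
    (hP : IsUpperSemimodular P) {x : P} {B : Set P} (hB : Good x B) :
    (hPolynomial (e x) (upperClosure B : Set P)).coeff ∈
      Set.Icc 0 (hPolynomial (e x) (Set.Ioi x)).coeff := by
  induction x using WellFoundedGT.induction generalizing B with
  | _ x ih =>
  have ih_covers := fun b (hb : x ⋖ b) B (hB : Good b B) => ih b hb.lt hB
  exact ⟨h.coeff_hPolynomial_nonneg_of_covers he hP ih_covers hB,
    h.coeff_hPolynomial_le_of_covers he hP ih_covers hB⟩

theorem coeff_hPolynomial_Ioi_nonneg (h : IsShellingFamily Good) (he : IsCorank e)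
    (hP : IsUpperSemimodular P) (x : P) : 0 ≤ (hPolynomial (e x) (Set.Ioi x)).coeff := by
  rw [← upperClosure_covers]
  exact (h.coeff_hPolynomial_mem_Icc he hP (h.covers x)).1

end IsShellingFamily

end Shelling


section Moebius

variable {P : Type*} [PartialOrder P] [LocallyFiniteOrder P] [OrderBot P]

instance wellFoundedLT_of_locallyFiniteOrder : WellFoundedLT P :=
  StrictMono.wellFoundedLT (f := fun x : P => (Finset.Icc ⊥ x).card) fun _ _ h =>
    Finset.card_lt_card (Finset.Icc_ssubset_Icc_right bot_le le_rfl h)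

open scoped Classical in
/-- Weisner's theorem. -/
theorem sum_mu_isLUB_eq_zero [DecidableEq P] {a z : P} (ha : ⊥ < a) (haz : a ≤ z)
    (hlub : ∀ y ≤ z, ∃ w, IsLUB {y, a} w) :
    ∑ y ∈ Finset.Icc ⊥ z with IsLUB {y, a} z, IncidenceAlgebra.mu ℤ ⊥ y = 0 := by
  induction z using WellFoundedLT.induction with
  | _ z ih =>
  choose! join hjoin using hlub
  have hmaps : ∀ y ∈ Finset.Icc ⊥ z, join y ∈ Finset.Icc a z := fun y hy => by
    have hyz := (Finset.mem_Icc.mp hy).2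
    exact Finset.mem_Icc.mpr ⟨(hjoin y hyz).1 (by simp),
      (hjoin y hyz).2 (by simp [upperBounds, hyz, haz])⟩
  have hfiber : ∀ w ∈ Finset.Icc a z, (Finset.Icc ⊥ z).filter (join · = w) =
      (Finset.Icc ⊥ w).filter (IsLUB {·, a} w) := fun w hw => by
    ext y
    simp only [Finset.mem_filter, Finset.mem_Icc, bot_le, true_and]
    constructor
    · rintro ⟨hyz, rfl⟩
      exact ⟨(hjoin y hyz).1 (by simp), hjoin y hyz⟩
    · rintro ⟨hyw, hlub⟩
      have hyz := hyw.trans (Finset.mem_Icc.mp hw).2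
      exact ⟨hyz, (hjoin y hyz).unique hlub⟩
  have hsum := IncidenceAlgebra.sum_Icc_mu_right (𝕜 := ℤ) ⊥ z
  rw [if_neg (ha.trans_le haz).ne, ← Finset.sum_fiberwise_of_maps_to hmaps,
    Finset.sum_congr rfl fun w hw => by rw [hfiber w hw],
    Finset.sum_eq_single_of_mem z (Finset.right_mem_Icc.mpr haz)] at hsum
  · exact hsum
  · intro w hw hwz
    obtain ⟨haw, hle⟩ := Finset.mem_Icc.mp hw
    exact ih w (lt_of_le_of_ne hle hwz) haw fun y hy => ⟨join y, hjoin y (hy.trans hle)⟩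

theorem IsUpperSemimodular.neg_one_pow_mul_mu_nonneg [DecidableEq P]
    (hP : IsUpperSemimodular P) {r : P → ℕ} (hbot : r ⊥ = 0)
    (hcov : ∀ x y, x ⋖ y → r y = r x + 1) (z : P) :
    0 ≤ (-1) ^ r z * IncidenceAlgebra.mu ℤ ⊥ z := by
  classical
  induction z using WellFoundedLT.induction with
  | _ z ih =>
  rcases eq_or_ne z ⊥ with rfl | hz
  · simp [hbot]
  obtain ⟨a, ha, haz⟩ := exists_covBy_le_of_lt (bot_lt_iff_ne_bot.mpr hz)
  have hlub : ∀ y ≤ z, ∃ w, IsLUB {y, a} w ∧ y ⩿ w := fun y hy => hP ha bot_le haz hy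
  have hweisner := sum_mu_isLUB_eq_zero ha.lt haz fun y hy => (hlub y hy).imp fun _ => And.left
  have hz_mem : z ∈ (Finset.Icc ⊥ z).filter (IsLUB {·, a} z) :=
    Finset.mem_filter.mpr ⟨Finset.right_mem_Icc.mpr bot_le, by simp [upperBounds, haz],
      fun u hu => hu (by simp)⟩
  rw [← Finset.add_sum_erase _ _ hz_mem] at hweisner
  rw [eq_neg_of_add_eq_zero_left hweisner, mul_neg, ← neg_mul, Finset.mul_sum]
  refine Finset.sum_nonneg fun y hy => ?_
  simp only [Finset.mem_erase, Finset.mem_filter, Finset.mem_Icc] at hy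
  obtain ⟨hyz, ⟨-, hle⟩, hjoin⟩ := hy
  obtain ⟨w, hw, hyw⟩ := hlub y hle
  obtain rfl : w = z := hw.unique hjoin
  have hcovBy : y ⋖ w := hyw.covBy_of_ne hyz
  rw [hcov y w hcovBy, pow_succ, mul_neg_one, neg_neg]
  exact ih y hcovBy.lt

theorem height_eq_of_covBy {r : P → ℕ} (hbot : r ⊥ = 0)
    (hcov : ∀ x y, x ⋖ y → r y = r x + 1) (x : P) : Order.height x = r x := by
  have hmono : StrictMono r :=
    (strictMono_iff_forall_covBy r).mpr fun x y h => by rw [hcov x y h]; exact Nat.lt_succ_self _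
  refine le_antisymm ?_ ?_
  · simpa using Order.height_le_height_apply_of_strictMono r hmono x
  · induction x using WellFoundedLT.induction with
    | _ x ih =>
    rcases eq_or_ne x ⊥ with rfl | hx
    · simp [hbot]
    obtain ⟨y, -, hy⟩ := exists_le_covBy_of_lt (bot_lt_iff_ne_bot.mpr hx)
    rw [hcov y x hy, Nat.cast_add_one]
    exact (add_le_add_left (ih y hy.lt) 1).trans (Order.height_add_one_le hy.lt)

end Moebius

section GeometricSeries

variable {ι : Type*} (R : Type*) [CommRing R]

/-- The power series `T / (1 - T)`, which enumerates the positive powers of a single variable. -/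
noncomputable def geomTail : PowerSeries R := PowerSeries.X * PowerSeries.mk 1

theorem geomTail_mul_one_sub_X : geomTail R * (1 - PowerSeries.X) = PowerSeries.X := by
  rw [geomTail, mul_assoc, PowerSeries.mk_one_mul_one_sub_eq_one, mul_one]

theorem coeff_geomTail (n : ℕ) : PowerSeries.coeff n (geomTail R) = if n = 0 then 0 else 1 := by
  cases n <;> simp [geomTail, PowerSeries.coeff_succ_X_mul]

open scoped Classical in
theorem coeff_geomTail_pow_card {σ s : Finset ι} (hσ : σ ⊆ s) (k : ℕ) :
    PowerSeries.coeff k (geomTail R ^ σ.card) =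
      ((Finset.finsuppAntidiag s k).filter fun m => m.support = σ).card := by
  have hfilter : (Finset.finsuppAntidiag s k).filter (fun m => m.support = σ) =
      (Finset.finsuppAntidiag σ k).filter fun m => m.support = σ := by
    ext m
    simp only [Finset.mem_filter, Finset.mem_finsuppAntidiag']
    refine and_congr_left ?_
    rintro rfl
    simp [hσ]
  rw [hfilter, ← Finset.prod_const, PowerSeries.coeff_prod, Finset.card_filter, Nat.cast_sum]
  refine Finset.sum_congr rfl fun m hm => ?_
  have hsub : m.support ⊆ σ := (Finset.mem_finsuppAntidiag.mp hm).2
  simp only [coeff_geomTail]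
  split_ifs with h
  · rw [Nat.cast_one]
    refine Finset.prod_eq_one fun i hi => if_neg ?_
    rwa [← h, Finsupp.mem_support_iff] at hi
  · obtain ⟨i, hi, him⟩ := Finset.exists_of_ssubset (lt_of_le_of_ne hsub h)
    rw [Nat.cast_zero]
    exact Finset.prod_eq_zero hi (if_pos (Finsupp.notMem_support_iff.mp him))

end GeometricSeries

section StanleyReisner

variable {ι : Type*}

theorem sum_single_one_le_iff {σ : Finset ι} {m : ι →₀ ℕ} :
    ∑ v ∈ σ, Finsupp.single v 1 ≤ m ↔ σ ⊆ m.support := by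
  classical
  simp only [Finsupp.le_def, Finsupp.finsetSum_apply, Finsupp.single_apply,
    Finset.sum_ite_eq', Finset.subset_iff, Finsupp.mem_support_iff]
  refine forall_congr' fun i => ?_
  split_ifs with hi <;> simp [hi, Nat.one_le_iff_ne_zero]

variable (F : Type*) [Field F] (Δ : AbstractSimplicialComplex ι)

theorem stanleyReisnerIdeal_eq_span_monomial : stanleyReisnerIdeal F Δ =
    Ideal.span ((fun m => MvPolynomial.monomial m (1 : F)) ''
      {m | ∃ σ : Finset ι, σ.Nonempty ∧ σ ∉ Δ.faces ∧ m = ∑ v ∈ σ, Finsupp.single v 1}) := by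
  rw [stanleyReisnerIdeal]
  congr 1
  ext p
  constructor
  · rintro ⟨σ, hne, hσ, rfl⟩
    exact ⟨_, ⟨σ, hne, hσ, rfl⟩, MvPolynomial.monomial_sum_one _ _⟩
  · rintro ⟨_, ⟨σ, hne, hσ, rfl⟩, rfl⟩
    exact ⟨σ, hne, hσ, MvPolynomial.monomial_sum_one _ _⟩

variable {F Δ} in
theorem mem_stanleyReisnerIdeal {f : MvPolynomial ι F} : f ∈ stanleyReisnerIdeal F Δ ↔
    ∀ m ∈ f.support, m.support.Nonempty ∧ m.support ∉ Δ.faces := by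
  rw [stanleyReisnerIdeal_eq_span_monomial, MvPolynomial.mem_ideal_span_monomial_image]
  refine forall₂_congr fun m _ => ?_
  constructor
  · rintro ⟨_, ⟨σ, hne, hσ, rfl⟩, hle⟩
    have hsub := sum_single_one_le_iff.mp hle
    exact ⟨hne.mono hsub, fun hm => hσ ((Δ.isRelLowerSet_faces hm).2 hsub hne)⟩
  · rintro ⟨hne, hm⟩
    exact ⟨_, ⟨m.support, hne, hm, rfl⟩, sum_single_one_le_iff.mpr le_rfl⟩

/-- The exponents of the monomials that form a basis of the graded piece `F[Δ]_k`: those of degree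
`k` supported on a face, the empty set counting as a face. -/
def faceExponents (k : ℕ) : Set (ι →₀ ℕ) :=
  {m | m.degree = k ∧ (m.support.Nonempty → m.support ∈ Δ.faces)}

theorem stanleyReisnerPiece_eq_map (k : ℕ) : stanleyReisnerPiece F Δ k =
    (MvPolynomial.restrictSupport F (faceExponents Δ k)).map
      (Ideal.Quotient.mkₐ F (stanleyReisnerIdeal F Δ)).toLinearMap := by
  have hhom : MvPolynomial.homogeneousSubmodule ι F k =
      MvPolynomial.restrictSupport F {m | m.degree = k} :=
    MvPolynomial.homogeneousSubmodule_eq_finsupp_supported ι F k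
  rw [stanleyReisnerPiece, hhom]
  refine le_antisymm ?_
    (Submodule.map_mono (MvPolynomial.restrictSupport_mono F fun m hm => hm.1))
  rw [MvPolynomial.restrictSupport_eq_span, Submodule.map_span, Submodule.span_le]
  rintro _ ⟨_, ⟨m, hm, rfl⟩, rfl⟩
  by_cases hface : m.support.Nonempty → m.support ∈ Δ.faces
  · exact Submodule.mem_map_of_mem
      ((MvPolynomial.monomial_mem_restrictSupport F).mpr (Or.inl ⟨hm, hface⟩))
  · have hmem : MvPolynomial.monomial m (1 : F) ∈ stanleyReisnerIdeal F Δ := by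
      rw [mem_stanleyReisnerIdeal]
      intro m' hm'
      rw [Finset.mem_singleton.mp (MvPolynomial.support_monomial_subset hm')]
      exact Classical.not_imp.mp hface
    have hzero : (Ideal.Quotient.mkₐ F (stanleyReisnerIdeal F Δ)).toLinearMap
        (MvPolynomial.monomial m (1 : F)) = 0 := Ideal.Quotient.eq_zero_iff_mem.mpr hmem
    rw [hzero]
    exact Submodule.zero_mem _

theorem finrank_stanleyReisnerPiece (k : ℕ) :
    Module.finrank F (stanleyReisnerPiece F Δ k) = (faceExponents Δ k).ncard := by
  set f := (Ideal.Quotient.mkₐ F (stanleyReisnerIdeal F Δ)).toLinearMap.domRestrict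
    (MvPolynomial.restrictSupport F (faceExponents Δ k))
  have hinj : Function.Injective f := by
    rw [← LinearMap.ker_eq_bot, LinearMap.ker_eq_bot']
    rintro ⟨p, hp⟩ hpzero
    have hmem := mem_stanleyReisnerIdeal.mp (Ideal.Quotient.eq_zero_iff_mem.mp hpzero)
    rw [MvPolynomial.mem_restrictSupport_iff] at hp
    refine Subtype.ext (MvPolynomial.support_eq_empty.mp ?_)
    exact Finset.eq_empty_of_forall_notMem fun m hm =>
      (hmem m hm).2 ((hp hm).2 (hmem m hm).1)
  have hrange : LinearMap.range f = stanleyReisnerPiece F Δ k := by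
    rw [stanleyReisnerPiece_eq_map, LinearMap.range_domRestrict]
  rw [← hrange, LinearMap.finrank_range_of_inj hinj,
    Module.finrank_eq_nat_card_basis (MvPolynomial.basisRestrictSupport F (faceExponents Δ k)),
    Nat.card_coe_set_eq]

open scoped Classical in
theorem stanleyReisnerHilbertSeries_eq [Fintype ι] : stanleyReisnerHilbertSeries F Δ =
    ∑ σ : Finset ι with σ.Nonempty → σ ∈ Δ.faces, geomTail ℚ ^ σ.card := by
  ext k
  have hset : faceExponents Δ k = ((Finset.finsuppAntidiag Finset.univ k).filter fun m =>
      m.support.Nonempty → m.support ∈ Δ.faces : Finset (ι →₀ ℕ)) := by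
    ext m
    simp [faceExponents, Finset.mem_finsuppAntidiag, Finsupp.degree_eq_sum]
  rw [stanleyReisnerHilbertSeries, PowerSeries.coeff_mk, finrank_stanleyReisnerPiece, hset,
    Set.ncard_coe_finset, map_sum,
    Finset.card_eq_sum_card_fiberwise (f := Finsupp.support)
      (t := Finset.univ.filter fun σ : Finset ι => σ.Nonempty → σ ∈ Δ.faces)
      (fun m hm => by simpa using (Finset.mem_filter.mp hm).2), Nat.cast_sum]
  refine Finset.sum_congr rfl fun σ hσ => ?_
  rw [coeff_geomTail_pow_card ℚ (Finset.subset_univ σ), Finset.filter_filter]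
  congr 2
  refine Finset.filter_congr fun m _ => and_iff_right_of_imp ?_
  rintro rfl
  exact (Finset.mem_filter.mp hσ).2

theorem stanleyReisnerHilbertSeries_orderComplex_mul {P : Type*} [PartialOrder P] [OrderBot P]
    [Fintype P] : stanleyReisnerHilbertSeries F (orderComplex P) * (1 - PowerSeries.X) =
      ∑ G ∈ chainsIn (Set.Ioi (⊥ : P)), geomTail ℚ ^ G.card := by
  classical
  have hfaces : (Finset.univ.filter fun σ : Finset P => σ.Nonempty → σ ∈ (orderComplex P).faces) =
      chainsIn (Set.Ici ⊥) := by
    ext σ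
    rw [Finset.mem_filter]
    rcases σ.eq_empty_or_nonempty with rfl | hσ
    · simp [empty_mem_chainsIn]
    · simp [mem_chainsIn, orderComplex, hσ]
  have hgeom : (1 + geomTail ℚ) * (1 - PowerSeries.X) = 1 := by
    linear_combination geomTail_mul_one_sub_X ℚ
  rw [stanleyReisnerHilbertSeries_eq, hfaces, sum_chainsIn_Ici_pow_card, mul_right_comm, hgeom,
    one_mul]

end StanleyReisner

theorem ratFunc_one_sub_X_ne_zero : (1 - RatFunc.X : RatFunc ℚ) ≠ 0 := fun h => by
  have hX := RatFunc.algebraMap_injective ℚ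
    (show algebraMap ℚ[X] (RatFunc ℚ) (1 - X) = algebraMap ℚ[X] (RatFunc ℚ) 0 by simpa using h)
  simpa using congrArg (Polynomial.eval 0) hX

theorem laurentExpansion_X : laurentExpansion RatFunc.X =
    ((PowerSeries.X : PowerSeries ℚ) : LaurentSeries ℚ) := by
  rw [PowerSeries.coe_X]
  exact RatFunc.coe_X

theorem laurentExpansion_one_sub_X : laurentExpansion (1 - RatFunc.X) =
    ((1 - PowerSeries.X : PowerSeries ℚ) : LaurentSeries ℚ) := by
  rw [map_sub, map_one, laurentExpansion_X, map_sub, map_one]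

theorem laurentExpansion_X_div_one_sub_X : laurentExpansion (RatFunc.X / (1 - RatFunc.X)) =
    ((geomTail ℚ : PowerSeries ℚ) : LaurentSeries ℚ) := by
  rw [map_div₀, div_eq_iff ((_root_.map_ne_zero _).mpr ratFunc_one_sub_X_ne_zero),
    laurentExpansion_one_sub_X, ← map_mul, geomTail_mul_one_sub_X, laurentExpansion_X]


namespace IsAffineHyperplane

variable {K : Type*} [Field K] {d : ℕ} {E H : AffineSubspace K (Fin d → K)} {v : Fin d → K}

theorem direction_sup_span_singleton (h : IsAffineHyperplane E H) (hv : v ∈ E.direction)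
    (hvH : v ∉ H.direction) : H.direction ⊔ Submodule.span K {v} = E.direction := by
  refine Submodule.eq_of_le_of_finrank_le
    (sup_le (AffineSubspace.direction_le h.le) (by simpa using hv)) ?_
  have hlt : H.direction < H.direction ⊔ Submodule.span K {v} :=
    left_lt_sup.mpr (by simpa using hvH)
  have hfinrank := Submodule.finrank_lt_finrank_of_lt hlt
  rw [← h.finrank_eq]
  exact hfinrank

/-- A point `p` can be moved into `H` along `v`, hence inside every affine subspace that contains
`p` and is parallel to `v`. -/
theorem exists_mem_of_notMem_direction (h : IsAffineHyperplane E H) {p : Fin d → K} (hp : p ∈ E)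
    (hv : v ∈ E.direction) (hvH : v ∉ H.direction) :
    ∃ q ∈ H, ∀ S : AffineSubspace K (Fin d → K), p ∈ S → v ∈ S.direction → q ∈ S := by
  obtain ⟨o, ho⟩ := h.nonempty
  have hpo : p -ᵥ o ∈ E.direction := AffineSubspace.vsub_mem_direction hp (h.le ho)
  rw [← h.direction_sup_span_singleton hv hvH, Submodule.mem_sup] at hpo
  obtain ⟨u, hu, w, hw, huw⟩ := hpo
  obtain ⟨c, rfl⟩ := Submodule.mem_span_singleton.mp hw
  refine ⟨u +ᵥ o, AffineSubspace.vadd_mem_of_mem_direction hu ho, fun S hpS hvS => ?_⟩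
  have hslide : u +ᵥ o = -c • v +ᵥ p := by
    simp only [vadd_eq_add, vsub_eq_sub] at huw ⊢
    rw [← sub_add_cancel p o, ← huw]
    module
  rw [hslide]
  exact AffineSubspace.vadd_mem_of_mem_direction (S.direction.smul_mem _ hvS) hpS

end IsAffineHyperplane

namespace HyperplaneArrangement

variable {K : Type*} [Field K] {d : ℕ} {A : HyperplaneArrangement K d}

namespace IntersectionPoset

variable {x y a b : A.IntersectionPoset} {H : AffineSubspace K (Fin d → K)}

theorem space_le_space : y.space ≤ x.space ↔ x ≤ y := Iff.rfl

theorem space_lt_space : y.space < x.space ↔ x < y := by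
  rw [lt_iff_le_not_ge, lt_iff_le_not_ge, space_le_space, space_le_space]

theorem space_injective : Function.Injective (space : A.IntersectionPoset → _) := fun _ _ h =>
  le_antisymm (space_le_space.mp h.ge) (space_le_space.mp h.le)

theorem exists_space_eq_inf (x : A.IntersectionPoset) (hH : H ∈ A.hyperplanes)
    {p : Fin d → K} (hp : p ∈ x.space ⊓ H) : ∃ y : A.IntersectionPoset, y.space = x.space ⊓ H := by
  classical
  obtain ⟨-, B, hB, hx : x.space = A.ambient ⊓ ⨅ H ∈ B, H⟩ := x.2
  refine ⟨⟨OrderDual.toDual (x.space ⊓ H), ⟨p, hp⟩, insert H B, Finset.insert_subset hH hB, ?_⟩,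
    rfl⟩
  rw [Finset.iInf_insert, OrderDual.ofDual_toDual, hx, inf_assoc, inf_comm H]

theorem exists_hyperplane (h : ¬ y ≤ x) : ∃ H ∈ A.hyperplanes, ¬ x.space ≤ H ∧ y.space ≤ H := by
  obtain ⟨-, B, hB, hy : y.space = A.ambient ⊓ ⨅ H ∈ B, H⟩ := y.2
  by_contra! hcon
  refine h (space_le_space.mp ?_)
  rw [hy]
  refine le_inf x.space_le_ambient (le_iInf₂ fun H hH => ?_)
  by_contra hxH
  exact hcon H (hB hH) hxH (hy.trans_le (inf_le_right.trans (iInf₂_le H hH)))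

/-- The dimension of a flat. -/
noncomputable def dim (x : A.IntersectionPoset) : ℕ := Module.finrank K x.space.direction

theorem dim_strictAnti : StrictAnti (dim : A.IntersectionPoset → ℕ) := fun _ y h =>
  Submodule.finrank_lt_finrank_of_lt
    (AffineSubspace.direction_lt_of_nonempty (space_lt_space.mpr h) y.2.1)

theorem dim_of_space_eq_inf (hH : H ∈ A.hyperplanes) (hxH : ¬ x.space ≤ H)
    (hy : y.space = x.space ⊓ H) : y.dim + 1 = x.dim := by
  have hinf := (A.isHyperplane H hH).inf x.space_le_ambient hxH (hy ▸ y.2.1)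
  rw [← hy] at hinf
  exact hinf.finrank_eq

theorem covBy_of_space_eq_inf (hH : H ∈ A.hyperplanes) (hxH : ¬ x.space ≤ H)
    (hy : y.space = x.space ⊓ H) : x ⋖ y := by
  refine ⟨space_lt_space.mp (hy.trans_lt (inf_lt_left.mpr hxH)), fun z hxz hzy => ?_⟩
  have := dim_strictAnti hxz
  have := dim_strictAnti hzy
  have := dim_of_space_eq_inf hH hxH hy
  omega

theorem covBy_iff : x ⋖ y ↔ ∃ H ∈ A.hyperplanes, ¬ x.space ≤ H ∧ y.space = x.space ⊓ H := by
  refine ⟨fun h => ?_, fun ⟨H, hH, hxH, hy⟩ => covBy_of_space_eq_inf hH hxH hy⟩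
  obtain ⟨H, hH, hxH, hyH⟩ := exists_hyperplane h.lt.not_ge
  have hyx : y.space ≤ x.space ⊓ H := le_inf (space_le_space.mpr h.le) hyH
  obtain ⟨p, hp⟩ := y.2.1
  obtain ⟨z, hz⟩ := x.exists_space_eq_inf hH (hyx hp)
  have hxz : x ⋖ z := covBy_of_space_eq_inf hH hxH hz
  have hzy : z ≤ y := space_le_space.mp (hyx.trans_eq hz.symm)
  obtain rfl : z = y := (h.eq_or_eq hxz.le hzy).resolve_left hxz.ne'
  exact ⟨H, hH, hxH, hz⟩

theorem dim_of_covBy (h : x ⋖ y) : y.dim + 1 = x.dim :=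
  let ⟨_, hH, hxH, hy⟩ := covBy_iff.mp h
  dim_of_space_eq_inf hH hxH hy

theorem direction_of_space_eq_inf (hy : y.space = x.space ⊓ H) :
    y.space.direction = x.space.direction ⊓ H.direction := by
  obtain ⟨p, hp⟩ := y.2.1
  have hp : p ∈ x.space ⊓ H := hy ▸ hp
  rw [hy, AffineSubspace.direction_inf_of_mem_inf hp]

theorem exists_covBy_of_not_direction_le (x : A.IntersectionPoset) (hH : H ∈ A.hyperplanes)
    (hxH : ¬ x.space.direction ≤ H.direction) :
    ∃ b : A.IntersectionPoset, x ⋖ b ∧ b.space = x.space ⊓ H := by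
  obtain ⟨v, hv, hvH⟩ := SetLike.not_le_iff_exists.mp hxH
  obtain ⟨p, hp⟩ := x.2.1
  obtain ⟨q, hqH, hq⟩ := (A.isHyperplane H hH).exists_mem_of_notMem_direction
    (x.space_le_ambient hp) (AffineSubspace.direction_le x.space_le_ambient hv) hvH
  obtain ⟨b, hb⟩ := x.exists_space_eq_inf hH ⟨hq x.space hp hv, hqH⟩
  exact ⟨b, covBy_of_space_eq_inf hH (mt AffineSubspace.direction_le hxH) hb, hb⟩

theorem isUpperSemimodular : IsUpperSemimodular A.IntersectionPoset := by
  intro x a y z hxa hxy haz hyz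
  obtain ⟨H, hH, -, ha⟩ := covBy_iff.mp hxa
  have hzH : z.space ≤ H := (space_le_space.mpr haz).trans (ha.trans_le inf_le_right)
  obtain ⟨p, hp⟩ := z.2.1
  obtain ⟨w, hw⟩ := y.exists_space_eq_inf hH ⟨space_le_space.mpr hyz hp, hzH hp⟩
  have hyw : y ≤ w := space_le_space.mp (hw.trans_le inf_le_left)
  have haw : a ≤ w := space_le_space.mp
    (hw.trans_le ((inf_le_inf_right H (space_le_space.mpr hxy)).trans_eq ha.symm))
  refine ⟨w, ⟨by simp [upperBounds, hyw, haw], fun u hu => space_le_space.mp ?_⟩, ?_⟩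
  · have hay : u.space ≤ a.space := space_le_space.mpr (hu (by simp))
    exact (le_inf (space_le_space.mpr (hu (by simp)))
      (hay.trans (ha.trans_le inf_le_right))).trans_eq hw.symm
  · by_cases hyH : y.space ≤ H
    · exact (space_injective (hw.trans (inf_eq_left.mpr hyH))).symm.wcovBy
    · exact (covBy_of_space_eq_inf hH hyH hw).wcovBy

theorem exists_covBy_space_eq_inf (ha : x ⋖ a) (hb : x ⋖ b) (hne : a ≠ b) {p : Fin d → K}
    (hpa : p ∈ a.space) (hpb : p ∈ b.space) :
    ∃ y : A.IntersectionPoset, b ⋖ y ∧ y.space = b.space ⊓ a.space := by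
  obtain ⟨H, hH, -, haH⟩ := covBy_iff.mp ha
  have hba : b.space ⊓ H = b.space ⊓ a.space := by
    rw [haH, ← inf_assoc, inf_eq_left.mpr (space_le_space.mpr hb.le)]
  have hbH : ¬ b.space ≤ H := fun hle => by
    have hab : a ≤ b := space_le_space.mp (inf_eq_left.mp (hba.symm.trans (inf_eq_left.mpr hle)))
    exact (hb.eq_or_eq ha.le hab).elim ha.ne' hne
  obtain ⟨y, hy⟩ := b.exists_space_eq_inf hH (p := p) (by rw [hba]; exact ⟨hpb, hpa⟩)
  exact ⟨y, covBy_of_space_eq_inf hH hbH hy, hy.trans hba⟩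

end IntersectionPoset

open IntersectionPoset

variable (A) in
/-- The lineality space of the arrangement: the directions common to the ambient space and all the
hyperplanes. -/
def lineality : Submodule K (Fin d → K) :=
  A.ambient.direction ⊓ ⨅ H ∈ A.hyperplanes, H.direction

theorem mem_lineality {v : Fin d → K} :
    v ∈ A.lineality ↔ v ∈ A.ambient.direction ∧ ∀ H ∈ A.hyperplanes, v ∈ H.direction := by
  simp [lineality, Submodule.mem_iInf]

theorem lineality_le_direction (x : A.IntersectionPoset) : A.lineality ≤ x.space.direction := by
  intro v hv
  obtain ⟨hvA, hvH⟩ := mem_lineality.mp hv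
  obtain ⟨⟨p, hp : p ∈ x.space⟩, B, hB, hx : x.space = A.ambient ⊓ ⨅ H ∈ B, H⟩ := x.2
  suffices hmem : v +ᵥ p ∈ x.space by simpa using AffineSubspace.vsub_mem_direction hmem hp
  simp only [hx, AffineSubspace.mem_inf_iff, AffineSubspace.mem_iInf_iff] at hp ⊢
  exact ⟨AffineSubspace.vadd_mem_of_mem_direction hvA hp.1, fun H hH =>
    AffineSubspace.vadd_mem_of_mem_direction (hvH H (hB hH)) (hp.2 H hH)⟩

theorem direction_le_lineality_of_isMax {x : A.IntersectionPoset} (hx : IsMax x) :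
    x.space.direction ≤ A.lineality := by
  refine fun v hv => mem_lineality.mpr
    ⟨AffineSubspace.direction_le x.space_le_ambient hv, fun H hH => ?_⟩
  by_contra hvH
  obtain ⟨b, hb, -⟩ := x.exists_covBy_of_not_direction_le hH fun hle => hvH (hle hv)
  exact hx.not_lt hb.lt

theorem isMax_of_direction_le_lineality {x : A.IntersectionPoset}
    (hx : x.space.direction ≤ A.lineality) : IsMax x :=
  isMax_iff_forall_not_lt.mpr fun y hxy => (dim_strictAnti hxy).not_ge
    (Submodule.finrank_mono (hx.trans (lineality_le_direction y)))

theorem rk_add_dim (x : A.IntersectionPoset) : A.rk x + x.dim = (⊥ : A.IntersectionPoset).dim := by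
  classical
  let _ : LocallyFiniteOrder A.IntersectionPoset := Fintype.toLocallyFiniteOrder
  have hdim : ∀ y : A.IntersectionPoset, y.dim ≤ (⊥ : A.IntersectionPoset).dim := fun y =>
    dim_strictAnti.antitone bot_le
  have hheight : Order.height x = ((⊥ : A.IntersectionPoset).dim - x.dim : ℕ) :=
    height_eq_of_covBy (r := fun x => (⊥ : A.IntersectionPoset).dim - x.dim) (Nat.sub_self _)
      (fun x y h => by have := dim_of_covBy h; have := hdim x; omega) x
  rw [rk, hheight, ENat.toNat_natCast, Nat.sub_add_cancel (hdim x)]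

theorem rk_bot : A.rk ⊥ = 0 := by
  simp [rk]

theorem rk_of_covBy {x y : A.IntersectionPoset} (h : x ⋖ y) : A.rk y = A.rk x + 1 := by
  have := rk_add_dim x
  have := rk_add_dim y
  have := dim_of_covBy h
  omega

theorem rk_le_rank (x : A.IntersectionPoset) : A.rk x ≤ A.rank :=
  Finset.le_sup (Finset.mem_univ x)

theorem rank_eq_rk_of_isMax {x : A.IntersectionPoset} (hx : IsMax x) : A.rank = A.rk x := by
  refine le_antisymm (Finset.sup_le fun y _ => ?_) (rk_le_rank x)
  have hdim : x.dim ≤ y.dim := Submodule.finrank_mono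
    ((direction_le_lineality_of_isMax hx).trans (lineality_le_direction y))
  have := rk_add_dim x
  have := rk_add_dim y
  omega

theorem isCorank : IsCorank fun x : A.IntersectionPoset => A.rank - A.rk x where
  covBy x b hb := by
    have := rk_of_covBy hb
    have := rk_le_rank b
    omega
  isMax _ hx := Nat.sub_eq_zero_of_le (rank_eq_rk_of_isMax hx).le

/-- A set of flats spans over `x` if the only directions it has in common with `x` are those of the
lineality space. -/
def IsSpanning (x : A.IntersectionPoset) (B : Set A.IntersectionPoset) : Prop :=
  ∀ v ∈ x.space.direction, (∀ b ∈ B, v ∈ b.space.direction) → v ∈ A.lineality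

/-- A set of flats is central if its members have a common point. -/
def IsCentral (B : Set A.IntersectionPoset) : Prop :=
  ∃ p, ∀ b ∈ B, p ∈ b.space

/-- The sets of covers of `x` that are spanning, or nonempty and central: the family along which the
intersection poset is shelled. -/
def IsGoodCoverSet (x : A.IntersectionPoset) (B : Set A.IntersectionPoset) : Prop :=
  (∀ b ∈ B, x ⋖ b) ∧ (IsSpanning x B ∨ B.Nonempty ∧ IsCentral B)

variable {x b : A.IntersectionPoset} {B : Set A.IntersectionPoset}

theorem IsSpanning.mono {C : Set A.IntersectionPoset} (h : IsSpanning x B) (hBC : B ⊆ C) :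
    IsSpanning x C := fun v hv hvC => h v hv fun b hb => hvC b (hBC hb)

theorem isSpanning_covers (x : A.IntersectionPoset) : IsSpanning x {b | x ⋖ b} := by
  refine fun v hv hvB => mem_lineality.mpr
    ⟨AffineSubspace.direction_le x.space_le_ambient hv, fun H hH => ?_⟩
  by_contra hvH
  obtain ⟨b, hb, hbH⟩ := x.exists_covBy_of_not_direction_le hH fun hle => hvH (hle hv)
  have hvb := hvB b hb
  rw [direction_of_space_eq_inf hbH] at hvb
  exact hvH hvb.2

theorem IsSpanning.coverTrace (hspan : IsSpanning x B) (hB : ∀ a ∈ B, x ⋖ a) (hb : x ⋖ b) :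
    IsSpanning b (coverTrace b B) := by
  intro v hv hvtrace
  have hbx := space_le_space.mpr hb.le
  have hvx := AffineSubspace.direction_le hbx hv
  refine hspan v hvx fun a haB => ?_
  obtain ⟨H, hH, -, haH⟩ := covBy_iff.mp (hB a haB)
  by_cases hbH : b.space.direction ≤ H.direction
  · rw [direction_of_space_eq_inf haH]
    exact ⟨hvx, hbH hv⟩
  · obtain ⟨y, hby, hyH⟩ := b.exists_covBy_of_not_direction_le hH hbH
    have hya : y.space ≤ a.space := by
      rw [hyH, haH]
      exact inf_le_inf_right H hbx
    exact AffineSubspace.direction_le hya (hvtrace y ⟨hby, a, haB, space_le_space.mp hya⟩)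

theorem mem_space_of_mem_coverTrace (hB : ∀ a ∈ B, x ⋖ a) (hb : x ⋖ b) (hbB : b ∉ B)
    {p : Fin d → K} (hpB : ∀ a ∈ B, p ∈ a.space) (hpb : p ∈ b.space) {y : A.IntersectionPoset}
    (hy : y ∈ coverTrace b B) : p ∈ y.space := by
  obtain ⟨hby, a, haB, hay⟩ := hy
  obtain ⟨z, hbz, hz⟩ := exists_covBy_space_eq_inf (hB a haB) hb (fun h => hbB (h ▸ haB))
    (hpB a haB) hpb
  have hzy : z ≤ y := space_le_space.mp
    ((le_inf (space_le_space.mpr hby.le) (space_le_space.mpr hay)).trans_eq hz.symm)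
  rw [← (hby.eq_or_eq hbz.le hzy).resolve_left hbz.ne', hz]
  exact ⟨hpb, hpB a haB⟩

theorem isGoodCoverSet_coverTrace_of_isSpanning (hspan : IsSpanning x B) (hB : ∀ a ∈ B, x ⋖ a)
    (hb : x ⋖ b) : IsGoodCoverSet b (coverTrace b B) :=
  ⟨fun _ hy => hy.1, Or.inl (hspan.coverTrace hB hb)⟩

theorem isGoodCoverSet_coverTrace_of_isCentral (hB : ∀ a ∈ B, x ⋖ a) (hb : x ⋖ b) (hbB : b ∉ B)
    (hne : B.Nonempty) (hcentral : IsCentral (insert b B)) :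
    IsGoodCoverSet b (coverTrace b B) := by
  obtain ⟨p, hp⟩ := hcentral
  obtain ⟨hpb, hpB⟩ := Set.forall_mem_insert.mp hp
  obtain ⟨a, haB⟩ := hne
  obtain ⟨y, hby, hy⟩ := exists_covBy_space_eq_inf (hB a haB) hb (fun h => hbB (h ▸ haB))
    (hpB a haB) hpb
  exact ⟨fun _ hy => hy.1, Or.inr
    ⟨⟨y, hby, a, haB, space_le_space.mp (hy.trans_le inf_le_right)⟩, p,
      fun _ => mem_space_of_mem_coverTrace hB hb hbB hpB hpb⟩⟩

/-- Moving a common point of `B` along a common direction that is not a direction of `H` yields a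
point of `H`, still common to `B`. -/
theorem exists_isCentral_insert (hne : B.Nonempty) (hB : ∀ a ∈ B, x ⋖ a) (hcentral : IsCentral B)
    (hspan : ¬ IsSpanning x B) : ∃ b ∉ B, x ⋖ b ∧ IsCentral (insert b B) := by
  obtain ⟨p, hp⟩ := hcentral
  simp only [IsSpanning, not_forall] at hspan
  obtain ⟨v, hv, hvB, hvl⟩ := hspan
  have hvA := AffineSubspace.direction_le x.space_le_ambient hv
  obtain ⟨H, hH, hvH⟩ : ∃ H ∈ A.hyperplanes, v ∉ H.direction := by
    simpa [mem_lineality, hvA] using hvl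
  obtain ⟨b, hb, hbH⟩ := x.exists_covBy_of_not_direction_le hH fun hle => hvH (hle hv)
  have hpx : p ∈ x.space := by
    obtain ⟨a, haB⟩ := hne
    exact space_le_space.mpr (hB a haB).le (hp a haB)
  obtain ⟨q, hqH, hq⟩ := (A.isHyperplane H hH).exists_mem_of_notMem_direction
    (x.space_le_ambient hpx) hvA hvH
  refine ⟨b, fun hbB => ?_, hb, q, Set.forall_mem_insert.mpr
    ⟨hbH ▸ ⟨hq x.space hpx hv, hqH⟩, fun a ha => hq a.space (hp a ha) (hvB a ha)⟩⟩
  have hvb := hvB b hbB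
  rw [direction_of_space_eq_inf hbH] at hvb
  exact hvH hvb.2

/-- Any maximal central subset of `B` will do. -/
theorem IsSpanning.exists_isCentral (hspan : IsSpanning x B) (hB : ∀ a ∈ B, x ⋖ a) :
    ∃ C ⊆ B, IsSpanning x C ∧ IsCentral C := by
  obtain ⟨C, ⟨hCB, p, hpx, hpC⟩, hmax⟩ :=
    {C | C ⊆ B ∧ ∃ p ∈ x.space, ∀ b ∈ C, p ∈ b.space}.toFinite.exists_maximal
      ⟨∅, Set.empty_subset B, x.2.1.imp fun p hp => ⟨hp, by simp⟩⟩
  refine ⟨C, hCB, fun v hv hvC => hspan v hv fun b hbB => ?_, p, hpC⟩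
  by_contra hvb
  obtain ⟨H, hH, -, hbH⟩ := covBy_iff.mp (hB b hbB)
  have hvH : v ∉ H.direction := fun h => hvb (direction_of_space_eq_inf hbH ▸ ⟨hv, h⟩)
  obtain ⟨q, hqH, hq⟩ := (A.isHyperplane H hH).exists_mem_of_notMem_direction
    (x.space_le_ambient hpx) (AffineSubspace.direction_le x.space_le_ambient hv) hvH
  have hqx := hq x.space hpx hv
  refine hvb (hvC b (hmax ?_ (Set.subset_insert b C) (Set.mem_insert b C)))
  exact ⟨Set.insert_subset hbB hCB, q, hqx, Set.forall_mem_insert.mpr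
    ⟨hbH ▸ ⟨hqx, hqH⟩, fun a ha => hq a.space (hpC a ha) (hvC a ha)⟩⟩

namespace IsGoodCoverSet

theorem exists_insert (h : IsGoodCoverSet x B) (hne : B ≠ {b | x ⋖ b}) :
    ∃ b ∉ B, x ⋖ b ∧ IsGoodCoverSet x (insert b B) ∧ IsGoodCoverSet b (coverTrace b B) := by
  obtain ⟨hB, hgood⟩ := h
  by_cases hspan : IsSpanning x B
  · obtain ⟨b, hb, hbB⟩ := Set.exists_of_ssubset (lt_of_le_of_ne hB hne)
    exact ⟨b, hbB, hb, ⟨Set.forall_mem_insert.mpr ⟨hb, hB⟩, Or.inl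
      (hspan.mono (Set.subset_insert b B))⟩, isGoodCoverSet_coverTrace_of_isSpanning hspan hB hb⟩
  · obtain ⟨hBne, hcentral⟩ := hgood.resolve_left hspan
    obtain ⟨b, hbB, hb, hins⟩ := exists_isCentral_insert hBne hB hcentral hspan
    exact ⟨b, hbB, hb, ⟨Set.forall_mem_insert.mpr ⟨hb, hB⟩, Or.inr ⟨Set.insert_nonempty b B, hins⟩⟩,
      isGoodCoverSet_coverTrace_of_isCentral hB hb hbB hBne hins⟩

theorem exists_diff (h : IsGoodCoverSet x B) : B.Subsingleton ∨
    ∃ b ∈ B, IsGoodCoverSet x (B \ {b}) ∧ IsGoodCoverSet b (coverTrace b (B \ {b})) := by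
  obtain ⟨hB, hgood⟩ := h
  have hBb : ∀ b, ∀ a ∈ B \ {b}, x ⋖ a := fun b a ha => hB a ha.1
  by_cases hcentral : IsCentral B
  · refine or_iff_not_imp_left.mpr fun hsub => ?_
    obtain ⟨a, haB, b, hbB, hab⟩ := Set.not_subsingleton_iff.mp hsub
    have hne : (B \ {b}).Nonempty := ⟨a, haB, hab⟩
    have hins : insert b (B \ {b}) = B := by
      rw [Set.insert_sdiff_singleton, Set.insert_eq_of_mem hbB]
    exact ⟨b, hbB, ⟨hBb b, Or.inr ⟨hne, hcentral.imp fun _ hp a ha => hp a ha.1⟩⟩,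
      isGoodCoverSet_coverTrace_of_isCentral (hBb b) (hB b hbB) (by simp) hne
        (hins.symm ▸ hcentral)⟩
  · have hspan := hgood.resolve_right fun h => hcentral h.2
    obtain ⟨C, hCB, hCspan, hC⟩ := hspan.exists_isCentral hB
    obtain ⟨b, hbB, hbC⟩ := Set.exists_of_ssubset
      (lt_of_le_of_ne hCB fun h => hcentral (h ▸ hC))
    have hdiff := hCspan.mono (Set.subset_sdiff_singleton hCB hbC)
    exact Or.inr ⟨b, hbB, ⟨hBb b, Or.inl hdiff⟩,
      isGoodCoverSet_coverTrace_of_isSpanning hdiff (hBb b) (hB b hbB)⟩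

theorem isMax (h : IsGoodCoverSet x ∅) : IsMax x := by
  have hspan := h.2.resolve_right fun h => Set.not_nonempty_empty h.1
  exact isMax_of_direction_le_lineality fun v hv => hspan v hv (by simp)

end IsGoodCoverSet

theorem isShellingFamily : IsShellingFamily (IsGoodCoverSet (A := A)) where
  covBy _ _ h := h.1
  covers x := ⟨fun _ => id, Or.inl (isSpanning_covers x)⟩
  isMax_of_empty _ := IsGoodCoverSet.isMax
  exists_insert _ _ := IsGoodCoverSet.exists_insert
  exists_diff _ _ := IsGoodCoverSet.exists_diff

theorem coeff_hPolynomial_flats_nonneg :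
    0 ≤ (hPolynomial A.rank (Set.Ioi (⊥ : A.IntersectionPoset))).coeff := by
  simpa only [rk_bot, Nat.sub_zero] using
    isShellingFamily.coeff_hPolynomial_Ioi_nonneg isCorank isUpperSemimodular
      (⊥ : A.IntersectionPoset)

open scoped Classical in
theorem neg_one_pow_mul_moebius_nonneg (x : A.IntersectionPoset) :
    0 ≤ (-1) ^ A.rk x * A.moebius x :=
  letI : LocallyFiniteOrder A.IntersectionPoset := Fintype.toLocallyFiniteOrder
  isUpperSemimodular.neg_one_pow_mul_mu_nonneg rk_bot (fun _ _ => rk_of_covBy) x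

theorem coeff_poincare_nonneg (k : ℕ) : 0 ≤ A.poincare.coeff k := by
  rw [poincare, finsetSum_coeff]
  refine Finset.sum_nonneg fun x _ => ?_
  rw [neg_pow, ← C_1, ← C_neg, ← C_pow, ← mul_assoc, ← C_mul, coeff_C_mul_X_pow]
  split_ifs
  · rw [mul_comm]
    exact neg_one_pow_mul_moebius_nonneg x
  · exact le_rfl

theorem eval_zero_poincare : A.poincare.eval 0 = 1 := by
  rw [poincare, eval_finsetSum, Finset.sum_eq_single_of_mem ⊥ (Finset.mem_univ _)]
  · simp [rk_bot, moebius]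
  · intro x _ hx
    obtain ⟨y, -, hy⟩ := exists_le_covBy_of_lt (bot_lt_iff_ne_bot.mpr hx)
    simp [rk_of_covBy hy]

theorem eq_of_hyperplanes_eq {A A' : HyperplaneArrangement K d} (hambient : A.ambient = A'.ambient)
    (hhyperplanes : A.hyperplanes = A'.hyperplanes) : A = A' := by
  cases A
  cases A'
  simp_all only

theorem restrict_bot : A.restrict ⊥ = A := by
  classical
  have hbot : (⊥ : A.IntersectionPoset).space = A.ambient := rfl
  have hinf : ∀ H ∈ A.hyperplanes, A.ambient ⊓ H = H := fun H hH =>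
    inf_eq_right.mpr (A.isHyperplane H hH).le
  have hmeet : ∀ H ∈ A.hyperplanes, ¬ A.ambient ≤ H ∧
      ((A.ambient ⊓ H : AffineSubspace K (Fin d → K)) : Set (Fin d → K)).Nonempty := by
    intro H hH
    rw [hinf H hH]
    refine ⟨fun hle => ?_, (A.isHyperplane H hH).nonempty⟩
    have := Submodule.finrank_mono (AffineSubspace.direction_le hle)
    have := (A.isHyperplane H hH).finrank_eq
    omega
  refine eq_of_hyperplanes_eq hbot ?_
  simp only [restrict, hbot]
  rw [Finset.filter_true_of_mem hmeet, Finset.image_congr hinf, Finset.image_id']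

theorem sub_bot : A.sub ⊥ = A := by
  simp [sub]

theorem flagPoincare_empty : A.flagPoincare ∅ = A.poincare := by
  have hnext : A.next ∅ ⊥ = ⊥ := by simp [next]
  rw [flagPoincare, insert_empty_eq, Finset.prod_singleton, hnext, restrict_bot, sub_bot]

theorem eval_zero_flagPoincare (F : Finset A.IntersectionPoset) :
    (A.flagPoincare F).eval 0 = 1 := by
  rw [flagPoincare, eval_prod]
  exact Finset.prod_eq_one fun _ _ => eval_zero_poincare

theorem eval_zero_map_flagPoincare {R : Type*} [CommRing R] (F : Finset A.IntersectionPoset) :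
    ((A.flagPoincare F).map (Int.castRingHom R)).eval 0 = 1 := by
  rw [eval_map, eval₂_at_zero, coeff_zero_eq_eval_zero, eval_zero_flagPoincare, map_one]

theorem flags_eq_chainsIn : A.flags = chainsIn (Set.Ioi ⊥) := by
  ext F
  simp only [flags, Finset.mem_filter, Finset.mem_univ, true_and, mem_chainsIn]
  refine and_congr_right fun _ => ⟨fun h y hy => ?_, fun h hb => Set.self_notMem_Ioi (h hb)⟩
  exact bot_lt_iff_ne_bot.mpr fun hb => h (hb ▸ hy)

theorem coarseNumerator_eq : A.coarseNumerator =
    ∑ F ∈ A.flags, (A.flagPoincare F).map (Int.castRingHom ℚ[X]) *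
      C (X ^ F.card * (1 - X) ^ (A.rank - F.card)) := by
  refine A.existsUnique_coarseNumerator.unique A.coarseNumerator_spec ?_
  have hweight : ∀ F ∈ A.flags, (RatFunc.X / (1 - RatFunc.X) : RatFunc ℚ) ^ F.card =
      algebraMap ℚ[X] (RatFunc ℚ) (X ^ F.card * (1 - X) ^ (A.rank - F.card)) *
        ((1 - RatFunc.X) ^ A.rank)⁻¹ := by
    intro F hF
    simp only [map_mul, map_pow, map_sub, map_one, RatFunc.algebraMap_X]
    rw [← div_eq_mul_inv, ← pow_sub_mul_pow _ (A.card_le_rank hF), mul_comm (_ ^ _) (_ ^ F.card),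
      mul_div_mul_right _ _ (pow_ne_zero _ ratFunc_one_sub_X_ne_zero), div_pow]
  rw [IsCoarseNumerator, coarseFlagHP, Polynomial.map_sum, Finset.sum_mul]
  refine Finset.sum_congr rfl fun F hF => ?_
  rw [hweight F hF, Polynomial.map_mul, Polynomial.map_map, Polynomial.map_C, C_mul, mul_assoc]
  congr 2
  exact RingHom.ext_int _ _

theorem coarseNumeratorTZero_eq :
    A.coarseNumeratorTZero = A.poincare.map (Int.castRingHom ℚ) := by
  have hring : (evalRingHom (0 : ℚ)).comp (Int.castRingHom ℚ[X]) = Int.castRingHom ℚ :=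
    RingHom.ext_int _ _
  have hempty : ∅ ∈ A.flags := by
    rw [flags_eq_chainsIn]
    exact empty_mem_chainsIn _
  rw [coarseNumeratorTZero, coarseNumerator_eq, Polynomial.map_sum,
    Finset.sum_eq_single_of_mem ∅ hempty]
  · rw [Polynomial.map_mul, Polynomial.map_map, hring, flagPoincare_empty, Polynomial.map_C]
    simp
  · intro F _ hF
    rw [Polynomial.map_mul, Polynomial.map_C]
    simp [hF]

theorem coarseNumeratorYZero_eq :
    A.coarseNumeratorYZero = hPolynomial A.rank (Set.Ioi (⊥ : A.IntersectionPoset)) := by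
  rw [coarseNumeratorYZero, coarseNumerator_eq, eval_finsetSum, hPolynomial, flags_eq_chainsIn]
  refine Finset.sum_congr rfl fun F _ => ?_
  rw [eval_mul, eval_C, eval_zero_map_flagPoincare, one_mul]

theorem eval_zero_coarseFlagHP : A.coarseFlagHP.eval 0 =
    ∑ F ∈ chainsIn (Set.Ioi (⊥ : A.IntersectionPoset)),
      (RatFunc.X / (1 - RatFunc.X)) ^ F.card := by
  rw [coarseFlagHP, eval_finsetSum, flags_eq_chainsIn]
  refine Finset.sum_congr rfl fun F _ => ?_
  rw [eval_mul, eval_C, eval_zero_map_flagPoincare, one_mul]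

theorem laurentExpansion_coarseFlagHP (F : Type*) [Field F] :
    laurentExpansion (A.coarseFlagHP.eval 0 / (1 - RatFunc.X)) =
      ((stanleyReisnerHilbertSeries F (orderComplex A.IntersectionPoset) : PowerSeries ℚ) :
        LaurentSeries ℚ) := by
  rw [map_div₀, div_eq_iff ((_root_.map_ne_zero _).mpr ratFunc_one_sub_X_ne_zero),
    laurentExpansion_one_sub_X, ← map_mul, stanleyReisnerHilbertSeries_orderComplex_mul,
    eval_zero_coarseFlagHP, map_sum, map_sum]
  exact Finset.sum_congr rfl fun G _ => by rw [map_pow, map_pow, laurentExpansion_X_div_one_sub_X]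

end HyperplaneArrangement

theorem mainTheorem6 {K : Type*} [Field K] {d : ℕ} (A : HyperplaneArrangement K d) :
    A.coarseNumeratorTZero = A.poincare.map (Int.castRingHom ℚ) ∧
    (∀ (F : Type*) [Field F],
      laurentExpansion (A.coarseFlagHP.eval 0 / (1 - RatFunc.X)) =
        ((stanleyReisnerHilbertSeries F (orderComplex A.IntersectionPoset) : PowerSeries ℚ) :
          LaurentSeries ℚ)) ∧
    (∀ k : ℕ, 0 ≤ A.coarseNumeratorTZero.coeff k) ∧
    (∀ k : ℕ, 0 ≤ A.coarseNumeratorYZero.coeff k) := by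
  refine ⟨HyperplaneArrangement.coarseNumeratorTZero_eq,
    fun F _ => HyperplaneArrangement.laurentExpansion_coarseFlagHP F, fun k => ?_, fun k => ?_⟩
  · rw [HyperplaneArrangement.coarseNumeratorTZero_eq, coeff_map]
    exact Int.cast_nonneg (HyperplaneArrangement.coeff_poincare_nonneg k)
  · rw [HyperplaneArrangement.coarseNumeratorYZero_eq]
    exact HyperplaneArrangement.coeff_hPolynomial_flats_nonneg k
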